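/- Let $\mathcal{A}$ be a semi-abelian category (pointed, Barr exact, Bourn protomodular, with binary coproducts) with enough projectives: every object is the codomain of a regular epimorphism whose domain is projective with respect to regular epimorphisms. A Birkhoff subcategory of $\mathcal{A}$ is a full reflective subcategory closed under subobjects and regular quotients. Let $\mathsf{Ab}(\mathcal{A})$ be the full subcategory of objects admitting an internal abelian group structure. Let $\mathcal{B}$ be a Birkhoff subcategory of $\mathcal{A}$ with reflector $I\colon\mathcal{A}\to\mathcal{B}$ and unit $\eta$. An extension is a regular epimorphism. An extension $f\colon B\to A$ is $\mathcal{B}$-trivial if the square $\eta_A\circ f=I(f)\circ\eta_B$ is a pullback, and $\mathcal{B}$-central if its pullback along some extension $E\to A$ is $\mathcal{B}$-trivial. An object $P$ is $\mathcal{B}$-perfect if $I(P)=0$. A $\mathcal{B}$-central extension $u\colon U\to A$ is weakly universal if for every $\mathcal{B}$-central extension $f\colon B\to A$ there is some $h\colon U\to B$ with $f\circ h=u$, and universal if there is always exactly one such $h$. Consider, for a $\mathcal{B}$-central extension $u\colon U\to A$, the conditions: 1. $U$ is $\mathcal{B}$-perfect and every $\mathcal{B}$-central extension of $U$ splits; 2.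 $U$ is $\mathcal{B}$-perfect and projective with respect to all $\mathcal{B}$-central extensions; 3. for every $\mathcal{B}$-central extension $f\colon X\to Y$ in $\mathcal{A}$, the map $f\circ(-)\colon\mathrm{Hom}(U,X)\to\mathrm{Hom}(U,Y)$ is a bijection; 4. $U$ is $\mathcal{B}$-perfect and $u$ is a weakly universal $\mathcal{B}$-central extension; 5. $u$ is a universal $\mathcal{B}$-central extension. Suppose that $\mathsf{Ab}(\mathcal{A})\subseteq\mathcal{B}$ and that conditions 1--5 are equivalent for every $\mathcal{B}$-central extension $u\colon U\to A$ in $\mathcal{A}$. Then, whenever $f\colon B\to A$ and $g\colon C\to B$ are $\mathcal{B}$-central extensions and $B$ is $\mathcal{B}$-perfect, the composite $f\circ g$ is a $\mathcal{B}$-central extension. In particular, if conditions 1--5 are equivalent for every $\mathsf{Ab}(\mathcal{A})$-central extension (that is, with $\mathcal{B}=\mathsf{Ab}(\mathcal{A})$), then $\mathcal{A}$ satisfies condition (UCE): whenever $f\colon B\to A$ and $g\colon C\to B$ are $\mathsf{Ab}(\mathcal{A})$-central extensions and $B$ is $\mathsf{Ab}(\mathcal{A})$-perfect, the composite $f\circ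 g$ is an $\mathsf{Ab}(\mathcal{A})$-central extension. -/

import Mathlib

open CategoryTheory CategoryTheory.Limits

universe v u

namespace SemiAb

/-- A semi-abelian category: pointed, with binary coproducts, Barr exact and Bourn protomodular.
Pointedness is expressed by a zero object together with the (necessarily unique) family of zero
morphisms. For pointed regular categories protomodularity is the regular Short Five Lemma. -/
class SemiAbelian (C : Type u) [Category.{v} C] [HasZeroMorphisms C] : Prop extends
    Regular C, HasZeroObject C, HasBinaryCoproducts C where
  /-- Barr exactness: every internal equivalence relation is effective. -/
  exists_isKernelPair : ∀ ⦃R X : C⦄ (p₁ p₂ : R ⟶ X), IsEquivalenceRelation p₁ p₂ →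
    ∃ (Y : C) (f : X ⟶ Y), IsKernelPair f p₁ p₂
  /-- The regular Short Five Lemma. -/
  short_five : ∀ ⦃B' A' B A : C⦄ (f' : B' ⟶ A') (f : B ⟶ A) (b : B' ⟶ B) (a : A' ⟶ A)
    (w : f' ≫ a = b ≫ f), IsRegularEpi f' → IsRegularEpi f →
    IsIso (kernel.map f' f b a w) → IsIso a → IsIso b

variable {C : Type u} [Category.{v} C]

/-- Projectivity with respect to regular epimorphisms. -/
def IsRegularProjective (P : C) : Prop :=
  ∀ ⦃B A : C⦄ (f : B ⟶ A), IsRegularEpi f → ∀ g : P ⟶ A, ∃ h : P ⟶ B, h ≫ f = g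

variable (C) in
/-- Enough (regular) projectives: every object is a regular quotient of a projective one. -/
def EnoughRegularProjectives : Prop :=
  ∀ A : C, ∃ (P : C) (p : P ⟶ A), IsRegularProjective P ∧ IsRegularEpi p

/-- The morphism `η : X ⟶ Y` is a reflection of `X` in the full subcategory of objects satisfying
`B`, that is, a component at `X` of the unit of a left adjoint to the inclusion. -/
structure IsReflection (B : ObjectProperty C) {X Y : C} (η : X ⟶ Y) : Prop where
  prop : B Y
  existsUnique : ∀ ⦃Z : C⦄, B Z → ∀ g : X ⟶ Z, ∃! h : Y ⟶ Z, η ≫ h = g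

/-- Birkhoff subcategories: full reflective subcategories which are closed under subobjects and
regular quotients. -/
structure IsBirkhoff (B : ObjectProperty C) : Prop where
  reflective : ∀ X : C, ∃ (Y : C) (η : X ⟶ Y), IsReflection B η
  of_mono : ∀ ⦃X Y : C⦄ (m : X ⟶ Y), Mono m → B Y → B X
  of_regularEpi : ∀ ⦃X Y : C⦄ (e : X ⟶ Y), IsRegularEpi e → B X → B Y

/-- An extension `f : Y ⟶ X` is `B`-trivial when its naturality square with respect to the unit of
the reflection in `B` is a pullback. The morphism `bf` below is the image of `f` under the
reflector: it is the only one that makes the square commute. -/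
def IsTrivialExtension (B : ObjectProperty C) {Y X : C} (f : Y ⟶ X) : Prop :=
  IsRegularEpi f ∧ ∃ (bY bX : C) (ηY : Y ⟶ bY) (ηX : X ⟶ bX) (bf : bY ⟶ bX),
    IsReflection B ηY ∧ IsReflection B ηX ∧ IsPullback f ηY ηX bf

/-- An extension `f : Y ⟶ X` is `B`-central when its pullback `f' : D ⟶ E` along some extension
`p : E ⟶ X` is `B`-trivial. -/
def IsCentralExtension (B : ObjectProperty C) {Y X : C} (f : Y ⟶ X) : Prop :=
  IsRegularEpi f ∧ ∃ (D E : C) (p : E ⟶ X) (q : D ⟶ Y) (f' : D ⟶ E),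
    IsRegularEpi p ∧ IsPullback q f' f p ∧ IsTrivialExtension B f'

/-- An object is `B`-perfect when its reflection in `B` is zero. -/
def IsPerfect (B : ObjectProperty C) (X : C) : Prop :=
  ∃ (Y : C) (η : X ⟶ Y), IsReflection B η ∧ IsZero Y

/-- Weakly universal `B`-central extensions of `A`: weakly initial objects of the category of
`B`-central extensions of `A`. -/
def IsWeaklyUniversalCentralExtension (B : ObjectProperty C) {U A : C} (u : U ⟶ A) : Prop :=
  IsCentralExtension B u ∧
    ∀ ⦃Y : C⦄ (f : Y ⟶ A), IsCentralExtension B f → ∃ h : U ⟶ Y, h ≫ f = u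

/-- Universal `B`-central extensions of `A`: initial objects of the category of
`B`-central extensions of `A`. -/
def IsUniversalCentralExtension (B : ObjectProperty C) {U A : C} (u : U ⟶ A) : Prop :=
  IsCentralExtension B u ∧
    ∀ ⦃Y : C⦄ (f : Y ⟶ A), IsCentralExtension B f → ∃! h : U ⟶ Y, h ≫ f = u

/-- For every `B`-central extension `u : U ⟶ A`, the following are equivalent:
(1) `U` is `B`-perfect and every `B`-central extension of `U` splits;
(2) `U` is `B`-perfect and projective with respect to all `B`-central extensions;
(3) `Hom(U, f)` is a bijection for every `B`-central extension `f`;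
(4) `U` is `B`-perfect and `u` is a weakly universal `B`-central extension;
(5) `u` is a universal `B`-central extension. -/
def UniversalityConditionsEquivalent (B : ObjectProperty C) : Prop :=
  ∀ ⦃U A : C⦄ (u : U ⟶ A), IsCentralExtension B u →
    List.TFAE
      [IsPerfect B U ∧
        ∀ ⦃Y : C⦄ (f : Y ⟶ U), IsCentralExtension B f → ∃ s : U ⟶ Y, s ≫ f = 𝟙 U,
       IsPerfect B U ∧
        ∀ ⦃Y X : C⦄ (f : Y ⟶ X), IsCentralExtension B f → ∀ g : U ⟶ X, ∃ h : U ⟶ Y, h ≫ f = g,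
       ∀ ⦃Y X : C⦄ (f : Y ⟶ X), IsCentralExtension B f →
        Function.Bijective (fun h : U ⟶ Y => h ≫ f),
       IsPerfect B U ∧ IsWeaklyUniversalCentralExtension B u,
       IsUniversalCentralExtension B u]

variable (C) in
/-- `Ab(C)`: the objects that admit an internal abelian group structure. -/
def abelianObjects [HasFiniteProducts C] : ObjectProperty C := fun X =>
  letI : CartesianMonoidalCategory C := CartesianMonoidalCategory.ofHasFiniteProducts
  letI : BraidedCategory C := BraidedCategory.ofCartesianMonoidalCategory
  ∃ _ : GrpObj X, IsCommMonObj X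

variable (C) in
/-- The universal central extension condition (UCE): if `Y` is an `Ab(C)`-perfect object then the
composite of two `Ab(C)`-central extensions `Z ⟶ Y ⟶ X` is again `Ab(C)`-central. -/
def ConditionUCE [HasFiniteProducts C] : Prop :=
  ∀ ⦃Z Y X : C⦄ (f : Y ⟶ X) (g : Z ⟶ Y), IsPerfect (abelianObjects C) Y →
    IsCentralExtension (abelianObjects C) f → IsCentralExtension (abelianObjects C) g →
    IsCentralExtension (abelianObjects C) (g ≫ f)

end SemiAb

/-! Call the kernel of the unit at `X` the commutator of `X`. Since `B` is Birkhoff, regular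
epimorphisms are surjective on commutators, so by the Short Five Lemma an extension is trivial
exactly when it is injective on commutators, and central when some pullback of it along an extension
is (`IsBirkhoff.isCentralExtension_iff`). Hence, if `f` is central and `h ≫ f` is a regular
epimorphism, `h` is surjective on commutators (`IsCentralExtension.exists_inCommutator_lift`).

Let `f : Y ⟶ X` and `g : Z ⟶ Y` be central with `Y` perfect. Then `X` is perfect, so it has a weakly
universal central extension `u` with perfect domain. Weak universality factors `u` through `f`, and
4 ⇒ 2 lifts the factor along `g`, so `u = k ≫ g ≫ f`. Pull back along an extension trivialising `u`:
the pullback of `k` is surjective on commutators because `g` is central, so injectivity on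
commutators passes from `u` to `g ≫ f`.

The case of `Ab(C)` needs only that it is Birkhoff. Its objects are those with a unital
multiplication, and the reflection is the cokernel of the diagonal. -/

namespace SemiAb

attribute [local simp] pullback.lift_fst pullback.lift_snd pullback.lift_fst_assoc
  pullback.lift_snd_assoc prod.lift_fst prod.lift_snd prod.lift_fst_assoc prod.lift_snd_assoc
  coprod.inl_desc coprod.inr_desc coprod.inl_desc_assoc coprod.inr_desc_assoc

/-! ### Regular categories -/

section RegularCategory

variable {C : Type u} [Category.{v} C] [Regular C]

lemma isRegularEpi_of_comp {X Y Z : C} (f : X ⟶ Y) (g : Y ⟶ Z) (h : IsRegularEpi (f ≫ g)) :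
    IsRegularEpi g :=
  have := strongEpi_of_strongEpi f g
  inferInstance

lemma isRegularEpi_comp {X Y Z : C} (f : X ⟶ Y) (g : Y ⟶ Z) (hf : IsRegularEpi f)
    (hg : IsRegularEpi g) : IsRegularEpi (f ≫ g) :=
  have := strongEpi_comp f g
  inferInstance

lemma exists_regularEpi_mono_fac {X Y : C} (f : X ⟶ Y) :
    ∃ (I : C) (e : X ⟶ I) (m : I ⟶ Y), IsRegularEpi e ∧ Mono m ∧ e ≫ m = f :=
  ⟨_, (Regular.strongEpiMonoFactorisation f).e, (Regular.strongEpiMonoFactorisation f).m,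
    inferInstance, inferInstance, by simp⟩

lemma isRegularEpi_of_isPullback {P X Y Z : C} {fst : P ⟶ X} {snd : P ⟶ Y} {f : X ⟶ Z}
    {g : Y ⟶ Z} (h : IsPullback fst snd f g) (hf : IsRegularEpi f) : IsRegularEpi snd :=
  Regular.regularEpiIsStableUnderBaseChange.of_isPullback h hf

/-- A morphism along which all elements with projective domain lift is a regular epimorphism. -/
lemma isRegularEpi_of_exists_lift (hC : EnoughRegularProjectives C) {X Y : C} (f : X ⟶ Y)
    (h : ∀ ⦃P : C⦄, IsRegularProjective P → ∀ y : P ⟶ Y, ∃ x : P ⟶ X, x ≫ f = y) :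
    IsRegularEpi f := by
  obtain ⟨P, p, hP, hp⟩ := hC Y
  obtain ⟨x, rfl⟩ := h hP p
  exact isRegularEpi_of_comp x f hp

lemma exists_desc_of_isRegularEpi {X Y Z : C} (f : X ⟶ Y) (hf : IsRegularEpi f) (g : X ⟶ Z)
    (h : ∀ ⦃T : C⦄ (a b : T ⟶ X), a ≫ f = b ≫ f → a ≫ g = b ≫ g) : ∃ d : Y ⟶ Z, f ≫ d = g :=
  IsRegularEpi.exists_of_isKernelPair f (IsKernelPair.of_hasPullback f) g
    (h _ _ pullback.condition)

end RegularCategory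

/-! ### Consequences of protomodularity and exactness -/

section Protomodular

variable {C : Type u} [Category.{v} C] [HasZeroMorphisms C] [SemiAbelian C]

/-- A subobject of the domain of a split epimorphism which contains both the section and the
kernel is the largest one. -/
lemma isIso_of_section_of_kernel {R B S : C} (f : R ⟶ B) (s : B ⟶ R) (hs : s ≫ f = 𝟙 B)
    (m : S ⟶ R) [Mono m] (hs' : ∃ s' : B ⟶ S, s' ≫ m = s)
    (hk : ∀ ⦃T : C⦄ (k : T ⟶ R), k ≫ f = 0 → ∃ k' : T ⟶ S, k' ≫ m = k) : IsIso m := by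
  obtain ⟨s', rfl⟩ := hs'
  have : IsSplitEpi f := ⟨⟨⟨_, hs⟩⟩⟩
  have : IsSplitEpi (m ≫ f) := ⟨⟨⟨s', by simpa using hs⟩⟩⟩
  refine SemiAbelian.short_five (m ≫ f) f m (𝟙 B) (by simp) inferInstance inferInstance ?_
    inferInstance
  obtain ⟨k', hk'⟩ := hk (kernel.ι f) (by simp)
  refine ⟨kernel.lift _ k' (by rw [← Category.assoc, hk']; simp), ?_, ?_⟩
  · rw [← cancel_mono (kernel.ι _), ← cancel_mono m]
    simp [hk']
  · rw [← cancel_mono (kernel.ι _)]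
    simp [hk']

/-- A morphism which vanishes on the kernel of `e` coequalizes the kernel pair of `e`. -/
lemma comp_eq_comp_of_kernel {X Y Z T : C} (e : X ⟶ Y) (g : X ⟶ Z)
    (h : ∀ ⦃T : C⦄ (k : T ⟶ X), k ≫ e = 0 → k ≫ g = 0) (x x' : T ⟶ X) (hx : x ≫ e = x' ≫ e) :
    x ≫ g = x' ≫ g := by
  -- Inside the kernel pair, this equalizer contains the diagonal, a section of the first
  -- projection, and the kernel of that projection, made of pairs `(0, k)` with `k ≫ e = 0`.
  have : IsIso (equalizer.ι (pullback.fst e e ≫ g) (pullback.snd e e ≫ g)) := by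
    refine isIso_of_section_of_kernel (pullback.fst e e) (pullback.lift (𝟙 X) (𝟙 X) rfl) (by simp)
      _ ⟨equalizer.lift (pullback.lift (𝟙 X) (𝟙 X) rfl) (by simp), by simp⟩
      (fun T k hk => ⟨equalizer.lift k ?_, equalizer.lift_ι _ _⟩)
    rw [reassoc_of% hk, ← Category.assoc, h (k ≫ pullback.snd e e), zero_comp]
    rw [Category.assoc, ← pullback.condition, reassoc_of% hk, zero_comp]
  have h' : pullback.fst e e ≫ g = pullback.snd e e ≫ g :=
    (cancel_epi (equalizer.ι _ _)).1 (equalizer.condition _ _)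
  simpa using congr(pullback.lift x x' hx ≫ $h')

/-- A regular epimorphism is a cokernel of its kernel. -/
lemma exists_desc_of_kernel {X Y Z : C} (e : X ⟶ Y) (he : IsRegularEpi e) (g : X ⟶ Z)
    (h : ∀ ⦃T : C⦄ (k : T ⟶ X), k ≫ e = 0 → k ≫ g = 0) : ∃ d : Y ⟶ Z, e ≫ d = g :=
  exists_desc_of_isRegularEpi e he g fun _ => comp_eq_comp_of_kernel e g h

/-- Internal relations are difunctional. -/
lemma exists_difunctional_of_mono {J X Y T : C} (m : J ⟶ X ⨯ Y) [Mono m] (r₁ r₂ r₃ : T ⟶ J)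
    (h₁₂ : r₁ ≫ m ≫ prod.snd = r₂ ≫ m ≫ prod.snd) (h₂₃ : r₂ ≫ m ≫ prod.fst = r₃ ≫ m ≫ prod.fst) :
    ∃ r : T ⟶ J, r ≫ m ≫ prod.fst = r₁ ≫ m ≫ prod.fst ∧
      r ≫ m ≫ prod.snd = r₃ ≫ m ≫ prod.snd := by
  let α := m ≫ prod.fst
  let β := m ≫ prod.snd
  -- `W` consists of triples `(r₁, r₂, r₃)` linked as in the hypotheses. The part where `t` lands in
  -- `J` contains the section `(r₁, r₂, r₂)`, witnessed by `r₁`, and the kernel `(0, 0, r₃)`,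
  -- witnessed by `r₃`.
  let W := pullback (pullback.snd β β) (pullback.fst α α)
  let w₁ : W ⟶ J := pullback.fst _ _ ≫ pullback.fst β β
  let w₃ : W ⟶ J := pullback.snd _ _ ≫ pullback.snd α α
  let t : W ⟶ X ⨯ Y := prod.lift (w₁ ≫ α) (w₃ ≫ β)
  have : IsIso (pullback.snd m t) := by
    refine isIso_of_section_of_kernel (pullback.fst (pullback.snd β β) (pullback.fst α α))
      (pullback.lift (𝟙 _) (pullback.snd β β ≫ pullback.lift (𝟙 _) (𝟙 _) rfl) (by simp)) (by simp)
      _ ⟨pullback.lift (pullback.fst β β) _ ?_, pullback.lift_snd _ _ _⟩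
      (fun T k hk => ⟨pullback.lift (k ≫ w₃) k ?_, pullback.lift_snd _ _ _⟩)
    · ext
      · simp [t, w₁, w₃, α]
      · simpa [t, w₁, w₃] using pullback.condition (f := β) (g := β)
    · ext
      · have h : k ≫ w₃ ≫ α = k ≫ w₁ ≫ α := by
          simp only [w₁, w₃, Category.assoc]
          rw [← pullback.condition (f := α) (g := α), ← pullback.condition_assoc]
          rw [reassoc_of% hk, reassoc_of% hk, zero_comp, zero_comp]
        simpa [t, α] using h
      · simp [t, β]
  let w : T ⟶ W := pullback.lift (pullback.lift r₁ r₂ h₁₂) (pullback.lift r₂ r₃ h₂₃) (by simp)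
  have hw : (w ≫ inv (pullback.snd m t) ≫ pullback.fst m t) ≫ m = w ≫ t := by
    simp [pullback.condition]
  refine ⟨w ≫ inv (pullback.snd m t) ≫ pullback.fst m t, ?_, ?_⟩
  · rw [← Category.assoc, hw]
    simp [t, w, w₁, α]
  · rw [← Category.assoc, hw]
    simp [t, w, w₃, β]

/-- The difunctionality of the relation given by the image of a span. -/
lemma exists_difunctional {G X Y P : C} (hP : IsRegularProjective P) (a : G ⟶ X) (b : G ⟶ Y)
    (g₁ g₂ g₃ : P ⟶ G) (h₁₂ : g₁ ≫ b = g₂ ≫ b) (h₂₃ : g₂ ≫ a = g₃ ≫ a) :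
    ∃ g : P ⟶ G, g ≫ a = g₁ ≫ a ∧ g ≫ b = g₃ ≫ b := by
  obtain ⟨J, e, m, he, hm, hem⟩ := exists_regularEpi_mono_fac (prod.lift a b)
  have ha : e ≫ m ≫ prod.fst = a := by rw [← Category.assoc, hem, prod.lift_fst]
  have hb : e ≫ m ≫ prod.snd = b := by rw [← Category.assoc, hem, prod.lift_snd]
  obtain ⟨r, hr₁, hr₂⟩ := exists_difunctional_of_mono m (g₁ ≫ e) (g₂ ≫ e) (g₃ ≫ e)
    (by simpa [hb] using h₁₂) (by simpa [ha] using h₂₃)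
  obtain ⟨g, rfl⟩ := hP e he r
  exact ⟨g, by simpa [ha] using hr₁, by simpa [hb] using hr₂⟩

/-- Graphs whose image is reflexive have coequalizers, with the image as kernel pair. -/
lemma exists_coequalizer_of_reflexive {G X X₀ : C} (a b : G ⟶ X) (c : X₀ ⟶ X)
    (hc : IsRegularEpi c) (s : X₀ ⟶ G) (ha : s ≫ a = c) (hb : s ≫ b = c) :
    ∃ (Z : C) (q : X ⟶ Z), IsRegularEpi q ∧ a ≫ q = b ≫ q ∧
      (∀ ⦃T : C⦄ (t : X ⟶ T), a ≫ t = b ≫ t → ∃ d : Z ⟶ T, q ≫ d = t) ∧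
      ∀ ⦃P : C⦄, IsRegularProjective P → ∀ x x' : P ⟶ X, x ≫ q = x' ≫ q →
        ∃ g : P ⟶ G, g ≫ a = x ∧ g ≫ b = x' := by
  obtain ⟨J, e, m, he, hm, hem⟩ := exists_regularEpi_mono_fac (prod.lift a b)
  have hea : e ≫ m ≫ prod.fst = a := by rw [← Category.assoc, hem, prod.lift_fst]
  have heb : e ≫ m ≫ prod.snd = b := by rw [← Category.assoc, hem, prod.lift_snd]
  obtain ⟨r, hr⟩ := exists_desc_of_isRegularEpi c hc (s ≫ e) fun T x y hxy => by
    rw [← cancel_mono m]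
    ext <;> simp [hea, heb, ha, hb, hxy]
  have hsa : r ≫ m ≫ prod.fst = 𝟙 X := by
    rw [← cancel_epi c, reassoc_of% hr, hea, ha, Category.comp_id]
  have hsb : r ≫ m ≫ prod.snd = 𝟙 X := by
    rw [← cancel_epi c, reassoc_of% hr, heb, hb, Category.comp_id]
  -- Symmetry is difunctionality for `(b, b), (a, b), (a, a)`; transitivity is difunctionality for
  -- `(a, b), (b, b), (b, c)`.
  obtain ⟨σ, hσ₁, hσ₂⟩ := exists_difunctional_of_mono m ((m ≫ prod.snd) ≫ r) (𝟙 J)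
    ((m ≫ prod.fst) ≫ r) (by simp [hsb]) (by simp [hsa])
  obtain ⟨τ, hτ₁, hτ₂⟩ := exists_difunctional_of_mono m
    (pullback.fst (m ≫ prod.snd) (m ≫ prod.fst))
    (pullback.fst (m ≫ prod.snd) (m ≫ prod.fst) ≫ (m ≫ prod.snd) ≫ r)
    (pullback.snd (m ≫ prod.snd) (m ≫ prod.fst)) (by simp [hsb])
    (by simpa [hsa] using pullback.condition (f := m ≫ prod.snd) (g := m ≫ prod.fst))
  have heq : IsEquivalenceRelation (m ≫ prod.fst) (m ≫ prod.snd) := ⟨⟨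
    { right_cancellation := fun T f g h₁ h₂ => by
        rw [← cancel_mono m]
        ext
        · simpa using h₁
        · simpa using h₂
      r := r
      reflexivity₁ := by exact hsa
      reflexivity₂ := by exact hsb
      s := σ
      symmetry₁ := by simpa [hsa] using hσ₁
      symmetry₂ := by simpa [hsb] using hσ₂
      c := _
      isLimit := pullbackIsPullback (m ≫ prod.snd) (m ≫ prod.fst)
      t := τ
      transitivity₁ := hτ₁
      transitivity₂ := hτ₂ }⟩⟩
  obtain ⟨Y, f, hf⟩ := SemiAbelian.exists_isKernelPair _ _ heq
  obtain ⟨Z, q, i, hq, hi, rfl⟩ := exists_regularEpi_mono_fac f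
  have hk : IsKernelPair q (m ≫ prod.fst) (m ≫ prod.snd) := hf.cancel_right_of_mono
  refine ⟨Z, q, hq, ?_, fun T t ht => ?_, fun P hP x x' hx => ?_⟩
  · rw [← hea, ← heb, Category.assoc, hk.w]
    simp only [Category.assoc]
  · refine IsRegularEpi.exists_of_isKernelPair q hk t ?_
    rw [← cancel_epi e, ← Category.assoc, hea, ← Category.assoc, heb, ht]
  · obtain ⟨g, hg⟩ := hP e he (hk.lift x x' hx)
    refine ⟨g, ?_, ?_⟩
    · rw [← hea, ← Category.assoc, hg, hk.lift_fst]
    · rw [← heb, ← Category.assoc, hg, hk.lift_snd]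

/-- Cokernels exist. -/
lemma exists_cokernel {N X : C} (k : N ⟶ X) : ∃ (Q : C) (q : X ⟶ Q), IsRegularEpi q ∧ k ≫ q = 0 ∧
    ∀ ⦃T : C⦄ (t : X ⟶ T), k ≫ t = 0 → ∃ d : Q ⟶ T, q ≫ d = t := by
  obtain ⟨Q, q, hq, h, hd, -⟩ := exists_coequalizer_of_reflexive (coprod.desc (𝟙 X) (0 : N ⟶ X))
    (coprod.desc (𝟙 X) k) (𝟙 X) inferInstance coprod.inl (by simp) (by simp)
  refine ⟨Q, q, hq, by simpa using congr(coprod.inr ≫ $h.symm), fun T t ht => hd t ?_⟩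
  ext <;> simp [ht]

end Protomodular

/-! ### Birkhoff subcategories and central extensions -/

section Birkhoff

variable {C : Type u} [Category.{v} C] [HasZeroMorphisms C]

/-- The generalized element `z` of `X` lies in the kernel of the reflection of `X` in `B`. -/
def InCommutator (B : ObjectProperty C) {Z X : C} (z : Z ⟶ X) : Prop :=
  ∀ ⦃Y : C⦄, B Y → ∀ g : X ⟶ Y, z ≫ g = 0

/-- The morphism `f` is injective on the kernels of the reflections in `B`. -/
def InjectiveOnCommutator (B : ObjectProperty C) {Y X : C} (f : Y ⟶ X) : Prop :=
  ∀ ⦃Z : C⦄ (z z' : Z ⟶ Y), InCommutator B z → InCommutator B z' → z ≫ f = z' ≫ f → z = z'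

variable {B : ObjectProperty C}

lemma InCommutator.comp {Z X Y : C} {z : Z ⟶ X} (hz : InCommutator B z) (f : X ⟶ Y) :
    InCommutator B (z ≫ f) := fun W hW g => by
  rw [Category.assoc, hz hW]

lemma InCommutator.precomp {W Z X : C} {z : Z ⟶ X} (hz : InCommutator B z) (w : W ⟶ Z) :
    InCommutator B (w ≫ z) := fun V hV g => by
  rw [Category.assoc, hz hV, comp_zero]

lemma InCommutator.of_epi_comp {W Z X : C} {z : Z ⟶ X} (w : W ⟶ Z) [Epi w]
    (h : InCommutator B (w ≫ z)) : InCommutator B z := fun V hV g => by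
  rw [← cancel_epi w, ← Category.assoc, h hV, comp_zero]

lemma IsReflection.inCommutator_iff {Z X Y : C} {η : X ⟶ Y} (hη : IsReflection B η) {z : Z ⟶ X} :
    InCommutator B z ↔ z ≫ η = 0 := by
  refine ⟨fun h => h hη.prop η, fun h W hW g => ?_⟩
  obtain ⟨d, rfl, -⟩ := hη.existsUnique hW g
  rw [reassoc_of% h, zero_comp]

lemma IsPerfect.inCommutator {X Z : C} (h : IsPerfect B X) (z : Z ⟶ X) : InCommutator B z := by
  obtain ⟨Y, η, hη, hY⟩ := h
  exact hη.inCommutator_iff.2 (hY.eq_of_tgt _ _)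

lemma InjectiveOnCommutator.of_isPullback {D E Y X : C} {q : D ⟶ Y} {f' : D ⟶ E} {f : Y ⟶ X}
    {p : E ⟶ X} (h : IsPullback q f' f p) (hf : InjectiveOnCommutator B f) :
    InjectiveOnCommutator B f' := by
  intro Z z z' hz hz' e
  refine h.hom_ext (hf _ _ (hz.comp q) (hz'.comp q) ?_) e
  rw [Category.assoc, h.w, reassoc_of% e, Category.assoc, h.w]

lemma injectiveOnCommutator_of_projective (hC : EnoughRegularProjectives C) {X Y : C} {f : Y ⟶ X}
    (h : ∀ ⦃P : C⦄, IsRegularProjective P → ∀ z z' : P ⟶ Y, InCommutator B z →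
      InCommutator B z' → z ≫ f = z' ≫ f → z = z') : InjectiveOnCommutator B f := by
  intro Z z z' hz hz' e
  obtain ⟨P, p, hP, hp⟩ := hC Z
  rw [← cancel_epi p]
  exact h hP _ _ (hz.precomp p) (hz'.precomp p) (by rw [Category.assoc, e, Category.assoc])

lemma InjectiveOnCommutator.mono_comp {U Y X : C} {f : Y ⟶ X} (hf : InjectiveOnCommutator B f)
    (m : U ⟶ Y) [Mono m] : InjectiveOnCommutator B (m ≫ f) := by
  intro Z z z' hz hz' e
  rw [← cancel_mono m]
  exact hf _ _ (hz.comp m) (hz'.comp m) (by simpa using e)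

variable [SemiAbelian C]

/-- Closure under subobjects puts the image of `η` in `B`; the universal property then splits its
inclusion. -/
lemma IsBirkhoff.isRegularEpi_of_isReflection (hB : IsBirkhoff B) {X Y : C} {η : X ⟶ Y}
    (hη : IsReflection B η) : IsRegularEpi η := by
  obtain ⟨I, e, m, he, hm, rfl⟩ := exists_regularEpi_mono_fac η
  obtain ⟨r, hr, -⟩ := hη.existsUnique (hB.of_mono m hm hη.prop) e
  have h : r ≫ m = 𝟙 Y := (hη.existsUnique hη.prop (e ≫ m)).unique
    (by rw [← Category.assoc, hr]) (by simp)
  have : IsSplitEpi m := ⟨⟨⟨r, h⟩⟩⟩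
  exact isRegularEpi_comp e m he inferInstance

lemma IsBirkhoff.isPerfect_of_inCommutator (hB : IsBirkhoff B) {X : C}
    (h : InCommutator B (𝟙 X)) : IsPerfect B X := by
  obtain ⟨Y, η, hη⟩ := hB.reflective X
  have := hB.isRegularEpi_of_isReflection hη
  refine ⟨Y, η, hη, (IsZero.iff_id_eq_zero _).2 ?_⟩
  rw [← cancel_epi η, ← Category.id_comp η, hη.inCommutator_iff.1 h, zero_comp, zero_comp]

/-- Elements of the kernel of the reflection lift along regular epimorphisms. -/
lemma IsBirkhoff.exists_inCommutator_lift (hB : IsBirkhoff B) {P X Y : C}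
    (hP : IsRegularProjective P) (f : Y ⟶ X) (hf : IsRegularEpi f) (x : P ⟶ X)
    (hx : InCommutator B x) : ∃ y : P ⟶ Y, InCommutator B y ∧ y ≫ f = x := by
  obtain ⟨IY, η, hη⟩ := hB.reflective Y
  have hηe := hB.isRegularEpi_of_isReflection hη
  -- Push the kernel pair of `η` forward along `f`. The quotient `Z` is a regular quotient of `IY`,
  -- so it lies in `B` and `x` dies in it; hence `(0, x)` comes from a pair `γ` in the kernel pair.
  obtain ⟨Z, q, hq, hab, -, hker⟩ := exists_coequalizer_of_reflexive (pullback.fst η η ≫ f)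
    (pullback.snd η η ≫ f) f hf (pullback.lift (𝟙 Y) (𝟙 Y) rfl) (by simp) (by simp)
  obtain ⟨d, hd⟩ := IsRegularEpi.exists_of_isKernelPair η (IsKernelPair.of_hasPullback η) (f ≫ q)
    (by simpa using hab)
  have hZ : B Z := hB.of_regularEpi d
    (isRegularEpi_of_comp η d (hd ▸ isRegularEpi_comp f q hf hq)) hη.prop
  obtain ⟨γ, hγ₁, hγ₂⟩ := hker hP 0 x (by rw [hx hZ, zero_comp])
  -- In place of a subtraction, difunctionality replaces `γ` by a pair `(0, y)` that still satisfies
  -- `y ≫ f = x`.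
  obtain ⟨g, hg₁, hg₂⟩ := exists_difunctional hP (pullback.snd η η ≫ f) (pullback.fst η η) γ
    ((γ ≫ pullback.fst η η) ≫ pullback.lift (𝟙 Y) (𝟙 Y) rfl) 0 (by simp) (by simpa using hγ₁)
  refine ⟨g ≫ pullback.snd η η, hη.inCommutator_iff.2 ?_, by rw [Category.assoc, hg₁, hγ₂]⟩
  rw [Category.assoc, ← pullback.condition, reassoc_of% hg₂, zero_comp]

/-- By Short Five over `bY`, the comparison from `Y` to the pullback is invertible once it is so on
kernels. There it is the map of commutators, which is always surjective. -/
lemma IsBirkhoff.isTrivialExtension_iff (hC : EnoughRegularProjectives C) (hB : IsBirkhoff B)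
    {Y X : C} {f : Y ⟶ X} :
    IsTrivialExtension B f ↔ IsRegularEpi f ∧ InjectiveOnCommutator B f := by
  constructor
  · rintro ⟨hf, bY, bX, ηY, ηX, bf, hY, hX, h⟩
    refine ⟨hf, fun Z z z' hz hz' e => h.hom_ext e ?_⟩
    rw [hY.inCommutator_iff.1 hz, hY.inCommutator_iff.1 hz']
  · rintro ⟨hf, hinj⟩
    obtain ⟨bY, ηY, hY⟩ := hB.reflective Y
    obtain ⟨bX, ηX, hX⟩ := hB.reflective X
    obtain ⟨bf, hbf, -⟩ := hY.existsUnique hX.prop (f ≫ ηX)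
    have hηY := hB.isRegularEpi_of_isReflection hY
    have hηX := hB.isRegularEpi_of_isReflection hX
    let b : Y ⟶ pullback ηX bf := pullback.lift f ηY hbf.symm
    have hw : ηY ≫ 𝟙 bY = b ≫ pullback.snd ηX bf := by simp [b]
    have hb : IsIso b := by
      refine SemiAbelian.short_five ηY (pullback.snd ηX bf) b (𝟙 bY) hw hηY inferInstance ?_
        inferInstance
      have hmono : Mono (kernel.map ηY (pullback.snd ηX bf) b (𝟙 bY) hw) := ⟨fun {T} z z' e => by
        rw [← cancel_mono (kernel.ι ηY)]
        refine hinj _ _ (hY.inCommutator_iff.2 (by simp)) (hY.inCommutator_iff.2 (by simp)) ?_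
        simpa [b] using congr(($e ≫ kernel.ι _) ≫ pullback.fst ηX bf)⟩
      have hepi : IsRegularEpi (kernel.map ηY (pullback.snd ηX bf) b (𝟙 bY) hw) := by
        refine isRegularEpi_of_exists_lift hC _ fun P hP x => ?_
        obtain ⟨y, hy, hyx⟩ := hB.exists_inCommutator_lift hP f hf
          (x ≫ kernel.ι _ ≫ pullback.fst ηX bf) (hX.inCommutator_iff.2 (by
            simp [pullback.condition]))
        refine ⟨kernel.lift _ y (hY.inCommutator_iff.1 hy), ?_⟩
        rw [← cancel_mono (kernel.ι _)]
        ext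
        · simpa [b] using hyx
        · simp [b, hY.inCommutator_iff.1 hy]
      exact isIso_of_mono_of_strongEpi _
    exact ⟨hf, bY, bX, ηY, ηX, bf, hY, hX,
      IsPullback.of_iso_pullback ⟨hbf.symm⟩ (asIso b) (by simp [b]) (by simp [b])⟩

lemma IsBirkhoff.isCentralExtension_iff (hC : EnoughRegularProjectives C) (hB : IsBirkhoff B)
    {Y X : C} {f : Y ⟶ X} : IsCentralExtension B f ↔ IsRegularEpi f ∧
      ∃ (E : C) (p : E ⟶ X), IsRegularEpi p ∧ InjectiveOnCommutator B (pullback.snd f p) := by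
  constructor
  · rintro ⟨hf, D, E, p, q, f', hp, h, ht⟩
    refine ⟨hf, E, p, hp, ?_⟩
    let i : pullback f p ⟶ D := h.lift _ _ pullback.condition
    have : Mono i := ⟨fun z z' e => by
      ext
      · simpa [i] using congr($e ≫ q)
      · simpa [i] using congr($e ≫ f')⟩
    simpa [i] using ((hB.isTrivialExtension_iff hC).1 ht).2.mono_comp i
  · rintro ⟨hf, E, p, hp, h⟩
    exact ⟨hf, _, E, p, _, _, hp, IsPullback.of_hasPullback f p,
      (hB.isTrivialExtension_iff hC).2 ⟨inferInstance, h⟩⟩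

/-- Subextensions of central extensions are central. -/
lemma IsCentralExtension.mono_comp (hC : EnoughRegularProjectives C) (hB : IsBirkhoff B)
    {U Y X : C} {f : Y ⟶ X} (hf : IsCentralExtension B f) (m : U ⟶ Y) [Mono m]
    (hm : IsRegularEpi (m ≫ f)) : IsCentralExtension B (m ≫ f) := by
  rw [hB.isCentralExtension_iff hC] at hf ⊢
  obtain ⟨-, E, p, hp, h⟩ := hf
  refine ⟨hm, E, p, hp, ?_⟩
  let i : pullback (m ≫ f) p ⟶ pullback f p :=
    pullback.lift (pullback.fst _ _ ≫ m) (pullback.snd _ _) (by simp [pullback.condition])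
  have : Mono i := ⟨fun z z' e => by
    ext
    · rw [← cancel_mono m]
      simpa [i] using congr($e ≫ pullback.fst f p)
    · simpa [i] using congr($e ≫ pullback.snd f p)⟩
  simpa [i] using h.mono_comp i

/-- Central extensions are stable under pullback. -/
lemma IsCentralExtension.of_isPullback (hC : EnoughRegularProjectives C) (hB : IsBirkhoff B)
    {Y' X' Y X : C} {q : Y' ⟶ Y} {f' : Y' ⟶ X'} {f : Y ⟶ X} {t : X' ⟶ X}
    (h : IsPullback q f' f t) (hf : IsCentralExtension B f) : IsCentralExtension B f' := by
  rw [hB.isCentralExtension_iff hC] at hf ⊢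
  obtain ⟨hf, E, p, hp, hinj⟩ := hf
  refine ⟨isRegularEpi_of_isPullback h hf, _, pullback.fst t p, inferInstance, ?_⟩
  intro Z z z' hz hz' e
  let i : pullback f' (pullback.fst t p) ⟶ pullback f p :=
    pullback.lift (pullback.fst _ _ ≫ q) (pullback.snd _ _ ≫ pullback.snd t p) (by
      rw [Category.assoc, h.w, pullback.condition_assoc, Category.assoc, pullback.condition])
  have hi : z ≫ i = z' ≫ i := hinj _ _ (hz.comp i) (hz'.comp i) (by simp [i, reassoc_of% e])
  refine pullback.hom_ext (h.hom_ext ?_ ?_) e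
  · simpa [i] using congr($hi ≫ pullback.fst f p)
  · rw [Category.assoc, pullback.condition, reassoc_of% e, Category.assoc, pullback.condition]

/-- Two morphisms into a central extension with the same composite agree on commutators. -/
lemma IsCentralExtension.comp_eq_comp (hC : EnoughRegularProjectives C) (hB : IsBirkhoff B)
    {T V Y X : C} {f : Y ⟶ X} (hf : IsCentralExtension B f) (a b : V ⟶ Y)
    (hab : a ≫ f = b ≫ f) (x : T ⟶ V) (hx : InCommutator B x) : x ≫ a = x ≫ b := by
  obtain ⟨P, c, hP, hc⟩ := hC T
  rw [← cancel_epi c]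
  obtain ⟨-, E, p, hp, hinj⟩ := (hB.isCentralExtension_iff hC).1 hf
  obtain ⟨y, hy, hyx⟩ := hB.exists_inCommutator_lift hP (pullback.fst (a ≫ f) p) inferInstance
    (c ≫ x) (hx.precomp c)
  let a' : pullback (a ≫ f) p ⟶ pullback f p :=
    pullback.lift (pullback.fst _ _ ≫ a) (pullback.snd _ _) (by simp [pullback.condition])
  let b' : pullback (a ≫ f) p ⟶ pullback f p :=
    pullback.lift (pullback.fst _ _ ≫ b) (pullback.snd _ _) (by
      rw [Category.assoc, ← hab, pullback.condition])
  have h := hinj _ _ (hy.comp a') (hy.comp b') (by simp [a', b'])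
  simpa [a', b', reassoc_of% hyx] using congr($h ≫ pullback.fst f p)

/-- If `h ≫ f` is a regular epimorphism and `f` is central, then `h` is surjective on
commutators. -/
lemma IsCentralExtension.exists_inCommutator_lift (hC : EnoughRegularProjectives C)
    (hB : IsBirkhoff B) {P U Y X : C} (hP : IsRegularProjective P) {f : Y ⟶ X}
    (hf : IsCentralExtension B f) (h : U ⟶ Y) (hh : IsRegularEpi (h ≫ f)) (y : P ⟶ Y)
    (hy : InCommutator B y) : ∃ x : P ⟶ U, InCommutator B x ∧ x ≫ h = y := by
  obtain ⟨-, E, p, hp, hinj⟩ := (hB.isCentralExtension_iff hC).1 hf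
  obtain ⟨d, hd, rfl⟩ := hB.exists_inCommutator_lift hP (pullback.fst f p) inferInstance y hy
  obtain ⟨z, hz, hzd⟩ := hB.exists_inCommutator_lift hP (pullback.snd (h ≫ f) p) inferInstance
    (d ≫ pullback.snd f p) (hd.comp _)
  let i : pullback (h ≫ f) p ⟶ pullback f p :=
    pullback.lift (pullback.fst _ _ ≫ h) (pullback.snd _ _) (by simp [pullback.condition])
  -- Both `z ≫ i` and `d` are commutators with the same image in `E`.
  have hi := hinj _ _ (hz.comp i) hd (by simpa [i] using hzd)
  exact ⟨z ≫ pullback.fst _ _, hz.comp _, by simp [← hi, i]⟩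

/-! ### Weakly universal central extensions and composition -/

lemma exists_isWeaklyUniversalCentralExtension (hC : EnoughRegularProjectives C)
    (hB : IsBirkhoff B) (A : C) :
    ∃ (W : C) (w : W ⟶ A), IsWeaklyUniversalCentralExtension B w := by
  obtain ⟨P, p, hP, hp⟩ := hC A
  obtain ⟨I, η, hη⟩ := hB.reflective (pullback p p)
  -- The image of `n ≫ pullback.fst p p` plays the role of the commutator of `P` and the kernel of
  -- `p` relative to `B`; `W` is the quotient of `P` by it.
  let n := kernel.ι (prod.lift (pullback.snd p p) η)
  have hn : n ≫ pullback.snd p p = 0 := by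
    simpa using congr($(kernel.condition (prod.lift (pullback.snd p p) η)) ≫ prod.fst)
  have hn' : n ≫ η = 0 := by
    simpa using congr($(kernel.condition (prod.lift (pullback.snd p p) η)) ≫ prod.snd)
  obtain ⟨W, q, hq, hnq, hdesc⟩ := exists_cokernel (n ≫ pullback.fst p p)
  obtain ⟨w, rfl⟩ := hdesc p (by
    rw [Category.assoc, pullback.condition, reassoc_of% hn, zero_comp])
  refine ⟨W, w, ?_, fun Y f hf => ?_⟩
  · refine (hB.isCentralExtension_iff hC).2 ⟨isRegularEpi_of_comp q w hp, W, w,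
      isRegularEpi_of_comp q w hp, injectiveOnCommutator_of_projective hC ?_⟩
    let ρ : pullback (q ≫ w) (q ≫ w) ⟶ pullback w w :=
      pullback.lift (pullback.fst _ _ ≫ q) (pullback.snd _ _ ≫ q) (by
        simpa using pullback.condition)
    have hρ : IsRegularEpi ρ := isRegularEpi_of_exists_lift hC _ fun T hT y => by
      obtain ⟨y₁, h₁⟩ := hT q hq (y ≫ pullback.fst w w)
      obtain ⟨y₂, h₂⟩ := hT q hq (y ≫ pullback.snd w w)
      refine ⟨pullback.lift y₁ y₂ ?_, ?_⟩
      · rw [reassoc_of% h₁, reassoc_of% h₂, pullback.condition]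
      · ext <;> simp [ρ, h₁, h₂]
    -- Commutators of `pullback w w` lie on the diagonal: a lift `r` and the diagonal element `r'`
    -- with the same second projection both lie in the kernel of `η`, and `ρ` kills the part of that
    -- kernel with zero second projection.
    have key : ∀ ⦃T : C⦄, IsRegularProjective T → ∀ z : T ⟶ pullback w w, InCommutator B z →
        z = z ≫ pullback.snd w w ≫ pullback.lift (𝟙 W) (𝟙 W) rfl := by
      intro T hT z hz
      obtain ⟨r, hr, rfl⟩ := hB.exists_inCommutator_lift hT ρ hρ z hz
      let r' := r ≫ pullback.snd _ _ ≫ pullback.lift (𝟙 P) (𝟙 P) (rfl : _ ≫ q ≫ w = _)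
      have hr' : InCommutator B r' := hr.comp _
      have := comp_eq_comp_of_kernel (kernel.ι η ≫ pullback.snd _ _) (kernel.ι η ≫ ρ)
        (fun S k hk => by
          have hk' : (k ≫ kernel.ι η) ≫ prod.lift (pullback.snd (q ≫ w) (q ≫ w)) η = 0 := by
            ext
            · simpa using hk
            · simp
          have hk'' : k ≫ kernel.ι η = kernel.lift _ _ hk' ≫ n := (kernel.lift_ι _ _ _).symm
          rw [← Category.assoc, hk'']
          ext
          · simpa [ρ] using congr(kernel.lift _ _ hk' ≫ $hnq)
          · simp [ρ, reassoc_of% hn])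
        (kernel.lift η r (hη.inCommutator_iff.1 hr)) (kernel.lift η r' (hη.inCommutator_iff.1 hr'))
        (by simp [r'])
      rw [kernel.lift_ι_assoc, kernel.lift_ι_assoc] at this
      rw [this]
      ext <;> simp [ρ, r']
    intro T hT z z' hz hz' e
    rw [key hT z hz, key hT z' hz', reassoc_of% e]
  · obtain ⟨h, hh⟩ := hP f hf.1 (q ≫ w)
    -- Centrality of `f` makes the two projections followed by `h` agree on `n`. The second one is
    -- zero there, so `h` factors through `W`.
    have := hf.comp_eq_comp hC hB (pullback.fst _ _ ≫ h) (pullback.snd _ _ ≫ h)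
      (by simpa [hh] using pullback.condition) n (hη.inCommutator_iff.2 hn')
    obtain ⟨d, rfl⟩ := hdesc h (by rw [Category.assoc, this, reassoc_of% hn, zero_comp])
    exact ⟨d, by rw [← cancel_epi q, ← hh, Category.assoc]⟩

/-- Perfect objects admit a perfect weakly universal central extension. -/
lemma IsPerfect.exists_isWeaklyUniversalCentralExtension (hC : EnoughRegularProjectives C)
    (hB : IsBirkhoff B) {A : C} (hA : IsPerfect B A) :
    ∃ (U : C) (u : U ⟶ A), IsPerfect B U ∧ IsWeaklyUniversalCentralExtension B u := by
  obtain ⟨W, w, hw, huniv⟩ := SemiAb.exists_isWeaklyUniversalCentralExtension hC hB A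
  obtain ⟨I, η, hη⟩ := hB.reflective W
  -- The commutator of `W` covers `A`, because every element of the perfect object `A` is a
  -- commutator.
  have hreg : IsRegularEpi (kernel.ι η ≫ w) := isRegularEpi_of_exists_lift hC _ fun P hP a => by
    obtain ⟨y, hy, rfl⟩ := hB.exists_inCommutator_lift hP w hw.1 a (hA.inCommutator a)
    exact ⟨kernel.lift η y (hη.inCommutator_iff.1 hy), by simp⟩
  refine ⟨_, kernel.ι η ≫ w, hB.isPerfect_of_inCommutator ?_, hw.mono_comp hC hB _ hreg,
    fun Y f hf => ?_⟩
  · obtain ⟨Q, c, hQ, hc⟩ := hC (kernel η)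
    -- Commutators of `W` lift to commutators of `kernel η` itself, so `kernel η` is its own
    -- commutator.
    obtain ⟨x, hx, hxc⟩ := hw.exists_inCommutator_lift hC hB hQ (kernel.ι η) hreg
      (c ≫ kernel.ι η) (hη.inCommutator_iff.2 (by simp))
    obtain rfl : x = c := (cancel_mono _).1 hxc
    exact InCommutator.of_epi_comp x (by simpa using hx)
  · obtain ⟨h, rfl⟩ := huniv f hf
    exact ⟨kernel.ι η ≫ h, by simp⟩

lemma IsPerfect.of_isRegularEpi (hB : IsBirkhoff B) {Y X : C} (hY : IsPerfect B Y) (f : Y ⟶ X)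
    (hf : IsRegularEpi f) : IsPerfect B X :=
  hB.isPerfect_of_inCommutator (InCommutator.of_epi_comp f (by simpa using hY.inCommutator (𝟙 Y) |>.comp f))

/-- If perfect weakly universal central extensions are projective with respect to central
extensions, then a composite of central extensions with perfect intermediate object is central. -/
theorem IsCentralExtension.comp (hC : EnoughRegularProjectives C) (hB : IsBirkhoff B)
    (huniv : UniversalityConditionsEquivalent B) {Z Y X : C} {f : Y ⟶ X} {g : Z ⟶ Y}
    (hY : IsPerfect B Y) (hf : IsCentralExtension B f) (hg : IsCentralExtension B g) :
    IsCentralExtension B (g ≫ f) := by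
  obtain ⟨U, u, hU, hu⟩ := (hY.of_isRegularEpi hB f hf.1).exists_isWeaklyUniversalCentralExtension
    hC hB
  obtain ⟨h, rfl⟩ := hu.2 f hf
  -- Positions count from zero: these are conditions 4 and 2.
  have h42 := (huniv _ hu.1).out 3 1
  obtain ⟨k, rfl⟩ := (h42.1 ⟨hU, hu⟩).2 g hg h
  have hreg : IsRegularEpi (k ≫ g) := isRegularEpi_of_exists_lift hC _ fun P hP y => by
    obtain ⟨x, -, hx⟩ := hf.exists_inCommutator_lift hC hB hP (k ≫ g) hu.1.1 y (hY.inCommutator y)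
    exact ⟨x, hx⟩
  obtain ⟨-, E, p, hp, hinj⟩ := (hB.isCentralExtension_iff hC).1 hu.1
  refine (hB.isCentralExtension_iff hC).2 ⟨isRegularEpi_comp g f hg.1 hf.1, E, p, hp,
    injectiveOnCommutator_of_projective hC fun P hP z z' hz hz' e => ?_⟩
  let g' : pullback (g ≫ f) p ⟶ pullback f p :=
    pullback.lift (pullback.fst _ _ ≫ g) (pullback.snd _ _) (by simp [pullback.condition])
  have hg' : IsCentralExtension B g' := by
    have : IsPullback (pullback.fst (g ≫ f) p) g' g (pullback.fst f p) := by
      refine IsPullback.of_bot ?_ (by simp [g']) (IsPullback.of_hasPullback f p)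
      simpa [g'] using IsPullback.of_hasPullback (g ≫ f) p
    exact hg.of_isPullback hC hB this
  let k' : pullback ((k ≫ g) ≫ f) p ⟶ pullback (g ≫ f) p :=
    pullback.lift (pullback.fst _ _ ≫ k) (pullback.snd _ _) (by
      simpa using pullback.condition (f := (k ≫ g) ≫ f) (g := p))
  have hk' : IsRegularEpi (k' ≫ g') := by
    have : IsPullback (pullback.fst ((k ≫ g) ≫ f) p) (k' ≫ g') (k ≫ g) (pullback.fst f p) := by
      refine IsPullback.of_bot ?_ (by simp [k', g']) (IsPullback.of_hasPullback f p)
      simpa [k', g'] using IsPullback.of_hasPullback ((k ≫ g) ≫ f) p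
    exact isRegularEpi_of_isPullback this hreg
  obtain ⟨x, hx, rfl⟩ := hg'.exists_inCommutator_lift hC hB hP k' hk' z hz
  obtain ⟨x', hx', rfl⟩ := hg'.exists_inCommutator_lift hC hB hP k' hk' z' hz'
  rw [hinj x x' hx hx' (by simpa [k'] using e)]

end Birkhoff

/-! ### Abelian objects as a Birkhoff subcategory -/

section Abelian

open MonoidalCategory CartesianMonoidalCategory

variable {C : Type u} [Category.{v} C] [HasZeroMorphisms C] [CartesianMonoidalCategory C]

variable (C) in
/-- The objects which admit a multiplication with the zero morphism as a two-sided unit. -/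
def unitalObjects : ObjectProperty C := fun X =>
  ∃ m : X ⊗ X ⟶ X, lift (𝟙 X) 0 ≫ m = 𝟙 X ∧ lift 0 (𝟙 X) ≫ m = 𝟙 X

lemma lift_zero_right_comp {X Y Z T : C} (m : X ⊗ Y ⟶ Z) (f : T ⟶ X) :
    lift f 0 ≫ m = f ≫ lift (𝟙 X) 0 ≫ m := by
  simp [← Category.assoc, comp_lift]

lemma lift_zero_left_comp {X Y Z T : C} (m : X ⊗ Y ⟶ Z) (f : T ⟶ Y) :
    lift 0 f ≫ m = f ≫ lift 0 (𝟙 Y) ≫ m := by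
  simp [← Category.assoc, comp_lift]

variable [SemiAbelian C]

/-- A subobject of a product which contains both axes is the largest one. -/
lemma isIso_of_axes {S X Y : C} (m : S ⟶ X ⊗ Y) [Mono m]
    (h₁ : ∃ s : X ⟶ S, s ≫ m = lift (𝟙 X) 0) (h₂ : ∃ s : Y ⟶ S, s ≫ m = lift 0 (𝟙 Y)) :
    IsIso m := by
  obtain ⟨s, hs⟩ := h₂
  refine isIso_of_section_of_kernel (fst X Y) (lift (𝟙 X) 0) (by simp) m h₁ fun T k hk =>
    ⟨(k ≫ snd X Y) ≫ s, ?_⟩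
  rw [Category.assoc, hs]
  ext <;> simp [hk]

/-- The equalizer contains both axes. -/
lemma hom_ext_of_axes {X Y Z : C} {f g : X ⊗ Y ⟶ Z}
    (h₁ : lift (𝟙 X) 0 ≫ f = lift (𝟙 X) 0 ≫ g) (h₂ : lift 0 (𝟙 Y) ≫ f = lift 0 (𝟙 Y) ≫ g) :
    f = g := by
  have := isIso_of_axes (equalizer.ι f g) ⟨equalizer.lift _ h₁, equalizer.lift_ι _ _⟩
    ⟨equalizer.lift _ h₂, equalizer.lift_ι _ _⟩
  exact (cancel_epi (equalizer.ι f g)).1 (equalizer.condition f g)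

/-- Morphisms with commuting composites along regular epimorphisms commute. -/
lemma exists_of_axes_of_isRegularEpi (hC : EnoughRegularProjectives C) {X X' Y Y' Z : C}
    (e : X ⟶ X') (e' : Y ⟶ Y') (he : IsRegularEpi e) (he' : IsRegularEpi e') (c : X ⊗ Y ⟶ Z)
    (t : X' ⟶ Z) (t' : Y' ⟶ Z) (h₁ : lift (𝟙 X) 0 ≫ c = e ≫ t)
    (h₂ : lift 0 (𝟙 Y) ≫ c = e' ≫ t') :
    ∃ m : X' ⊗ Y' ⟶ Z, lift (𝟙 X') 0 ≫ m = t ∧ lift 0 (𝟙 Y') ≫ m = t' := by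
  have hee : IsRegularEpi (e ⊗ₘ e') := isRegularEpi_of_exists_lift hC _ fun P hP y => by
    obtain ⟨y₁, h₁⟩ := hP e he (y ≫ fst _ _)
    obtain ⟨y₂, h₂⟩ := hP e' he' (y ≫ snd _ _)
    exact ⟨lift y₁ y₂, by ext <;> simp [h₁, h₂]⟩
  obtain ⟨m, hm⟩ := exists_desc_of_kernel (e ⊗ₘ e') hee c fun T k hk => by
    have hk₁ : (k ≫ fst _ _) ≫ e = 0 := by simpa using congr($hk ≫ fst _ _)
    have hk₂ : (k ≫ snd _ _) ≫ e' = 0 := by simpa using congr($hk ≫ snd _ _)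
    -- The kernel of `e ⊗ₘ e'` is the product of the two kernels, and `c` vanishes on both its axes.
    have h0 : (kernel.ι e ⊗ₘ kernel.ι e') ≫ c = 0 := by
      apply hom_ext_of_axes
      · rw [lift_map_assoc, zero_comp, Category.id_comp, lift_zero_right_comp, h₁]
        simp
      · rw [lift_map_assoc, zero_comp, Category.id_comp, lift_zero_left_comp, h₂]
        simp
    have : k = lift (kernel.lift e _ hk₁) (kernel.lift e' _ hk₂) ≫ (kernel.ι e ⊗ₘ kernel.ι e') := by
      ext <;> simp
    rw [this, Category.assoc, h0, comp_zero]
  refine ⟨m, ?_, ?_⟩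
  · rw [← cancel_epi e, ← h₁, ← hm, lift_map_assoc, ← lift_zero_right_comp]
    simp
  · rw [← cancel_epi e', ← h₂, ← hm, lift_map_assoc, ← lift_zero_left_comp]
    simp

/-- The shear morphism of a unital multiplication is invertible. -/
lemma isIso_lift_fst_mul {X : C} (m : X ⊗ X ⟶ X) (h : lift 0 (𝟙 X) ≫ m = 𝟙 X) :
    IsIso (lift (fst X X) m) := by
  have hs : IsSplitEpi (fst X X) := ⟨⟨⟨lift (𝟙 X) 0, by simp⟩⟩⟩
  have hw : fst X X ≫ 𝟙 X = lift (fst X X) m ≫ fst X X := by simp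
  refine SemiAbelian.short_five (fst X X) (fst X X) (lift (fst X X) m) (𝟙 X) hw inferInstance
    inferInstance ?_ inferInstance
  have : kernel.map _ _ _ _ hw = 𝟙 _ := by
    rw [← cancel_mono (kernel.ι _)]
    have hk : kernel.ι (fst X X) = lift 0 (kernel.ι (fst X X) ≫ snd X X) := by ext <;> simp
    have hk' : kernel.ι (fst X X) ≫ m = kernel.ι (fst X X) ≫ snd X X := by
      conv_lhs => rw [hk]
      rw [lift_zero_left_comp, h, Category.comp_id]
    ext <;> simp [hk']
  rw [this]
  infer_instance

/-- Unital objects have a subtraction. -/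
lemma exists_subtraction {X : C} (hX : unitalObjects C X) :
    ∃ d : X ⊗ X ⟶ X, lift (𝟙 X) 0 ≫ d = 𝟙 X ∧ lift (𝟙 X) (𝟙 X) ≫ d = 0 := by
  obtain ⟨m, h₁, h₂⟩ := hX
  have := isIso_lift_fst_mul m h₂
  have e₁ : lift 0 (𝟙 X) ≫ inv (lift (fst X X) m) = lift 0 (𝟙 X) := by
    rw [IsIso.comp_inv_eq]
    ext <;> simp [h₂]
  have e₂ : lift (𝟙 X) (𝟙 X) ≫ inv (lift (fst X X) m) = lift (𝟙 X) 0 := by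
    rw [IsIso.comp_inv_eq]
    ext <;> simp [h₁]
  -- `d(x, y)` is the solution `w` of `m(y, w) = x`.
  refine ⟨lift (snd X X) (fst X X) ≫ inv (lift (fst X X) m) ≫ snd X X, ?_, ?_⟩
  · have : lift (𝟙 X) (0 : X ⟶ X) ≫ lift (snd X X) (fst X X) = lift 0 (𝟙 X) := by ext <;> simp
    rw [reassoc_of% this, reassoc_of% e₁, lift_snd]
  · have : lift (𝟙 X) (𝟙 X) ≫ lift (snd X X) (fst X X) = lift (𝟙 X) (𝟙 X) := by ext <;> simp
    rw [reassoc_of% this, reassoc_of% e₂, lift_snd]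

/-- The unital objects are those which admit an internal abelian group structure. -/
lemma exists_grpObj_isCommMonObj_iff [BraidedCategory C] {X : C} :
    (∃ _ : GrpObj X, IsCommMonObj X) ↔ unitalObjects C X := by
  have h0 {T Y : C} (o : 𝟙_ C ⟶ Y) : toUnit T ≫ o = 0 := by
    rw [toUnit_unique (toUnit T) 0, zero_comp]
  constructor
  · rintro ⟨_, -⟩
    refine ⟨MonObj.mul, ?_, ?_⟩
    · rw [← h0 MonObj.one]
      exact MonObj.lift_comp_one_right _ _
    · rw [← h0 MonObj.one]
      exact MonObj.lift_comp_one_left _ _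
  · rintro ⟨m, h₁, h₂⟩
    have r (T : C) (f : T ⟶ X) : lift f 0 ≫ m = f := by
      rw [lift_zero_right_comp, h₁, Category.comp_id]
    have l (T : C) (f : T ⟶ X) : lift 0 f ≫ m = f := by
      rw [lift_zero_left_comp, h₂, Category.comp_id]
    -- As in the Eckmann–Hilton argument, commutativity and associativity need only be checked on
    -- axes, where they are the unit laws.
    have hcomm : (β_ X X).hom ≫ m = m := by
      apply hom_ext_of_axes
      · have : lift (𝟙 X) 0 ≫ (β_ X X).hom = lift 0 (𝟙 X) := by ext <;> simp
        rw [reassoc_of% this, h₁, h₂]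
      · have : lift 0 (𝟙 X) ≫ (β_ X X).hom = lift (𝟙 X) 0 := by ext <;> simp
        rw [reassoc_of% this, h₁, h₂]
    have := isIso_lift_fst_mul m h₂
    let i : X ⟶ X := lift (𝟙 X) 0 ≫ inv (lift (fst X X) m) ≫ snd X X
    have hi : lift (𝟙 X) i ≫ m = 0 := by
      have hw : lift (𝟙 X) i = lift (𝟙 X) 0 ≫ inv (lift (fst X X) m) := by
        ext
        · have : inv (lift (fst X X) m) ≫ fst X X = fst X X := by
            rw [IsIso.inv_comp_eq, lift_fst]
          simp [this]
        · simp [i]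
      have hm : inv (lift (fst X X) m) ≫ m = snd X X := by
        rw [IsIso.inv_comp_eq, lift_snd]
      rw [hw, Category.assoc, hm, lift_snd]
    have hi' : lift i (𝟙 X) ≫ m = 0 := by
      have : lift (𝟙 X) i ≫ (β_ X X).hom = lift i (𝟙 X) := by ext <;> simp
      rw [← this, Category.assoc, hcomm, hi]
    have hone : (0 : 𝟙_ C ⟶ X) ▷ X ≫ m = (λ_ X).hom := by
      rw [← cancel_epi (λ_ X).inv]
      have : (λ_ X).inv ≫ (0 : 𝟙_ C ⟶ X) ▷ X = lift 0 (𝟙 X) := by ext <;> simp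
      rw [reassoc_of% this, h₂, Iso.inv_hom_id]
    have hone' : X ◁ (0 : 𝟙_ C ⟶ X) ≫ m = (ρ_ X).hom := by
      rw [← cancel_epi (ρ_ X).inv]
      have : (ρ_ X).inv ≫ X ◁ (0 : 𝟙_ C ⟶ X) = lift (𝟙 X) 0 := by ext <;> simp
      rw [reassoc_of% this, h₁, Iso.inv_hom_id]
    have hassoc : m ▷ X ≫ m = (α_ X X X).hom ≫ X ◁ m ≫ m := by
      apply hom_ext_of_axes
      · have e₁ : lift (𝟙 (X ⊗ X)) 0 ≫ m ▷ X = lift m 0 := by ext <;> simp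
        have e₂ : lift (𝟙 (X ⊗ X)) 0 ≫ (α_ X X X).hom ≫ X ◁ m = 𝟙 (X ⊗ X) := by
          have : lift (𝟙 (X ⊗ X)) 0 ≫ (α_ X X X).hom = lift (fst X X) (lift (snd X X) 0) := by
            ext <;> simp
          rw [reassoc_of% this, lift_whiskerLeft, r, lift_fst_snd]
        rw [reassoc_of% e₁, reassoc_of% e₂, r]
      · have e₁ : lift 0 (𝟙 X) ≫ m ▷ X = lift 0 (𝟙 X) := by ext <;> simp
        have e₂ : lift 0 (𝟙 X) ≫ (α_ X X X).hom ≫ X ◁ m = lift 0 (𝟙 X) := by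
          have : lift 0 (𝟙 X) ≫ (α_ X X X).hom = lift 0 (lift 0 (𝟙 X)) := by
            ext <;> simp
          rw [reassoc_of% this, lift_whiskerLeft, l]
        rw [reassoc_of% e₁, reassoc_of% e₂]
    let G : GrpObj X :=
      { one := 0, mul := m, one_mul := hone, mul_one := hone', mul_assoc := hassoc, inv := i
        left_inv := by rw [hi', comp_zero]
        right_inv := by rw [hi, comp_zero] }
    exact ⟨G, ⟨hcomm⟩⟩

/-- Abelianization: every object has a reflection in the unital objects. -/
lemma exists_isReflection_unitalObjects (hC : EnoughRegularProjectives C) (X : C) :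
    ∃ (Q : C) (η : X ⟶ Q), IsReflection (unitalObjects C) η := by
  obtain ⟨Q, c, hc, hΔ, hdesc⟩ := exists_cokernel (lift (𝟙 X) (𝟙 X))
  have hη : IsRegularEpi (lift (𝟙 X) 0 ≫ c) := isRegularEpi_of_exists_lift hC _ fun P hP y => by
    obtain ⟨z, rfl⟩ := hP c hc y
    -- Comparing `z = (a, b)`, `(b, b)` and `0` gives an element `(a', 0)` with the same class as
    -- `z`, since `c` kills the diagonal.
    obtain ⟨g, hg₁, hg₂⟩ := exists_difunctional hP c (snd X X) z
      ((z ≫ snd X X) ≫ lift (𝟙 X) (𝟙 X)) 0 (by simp)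
      (by simp only [Category.assoc, hΔ, comp_zero, zero_comp])
    refine ⟨g ≫ fst X X, ?_⟩
    rw [← hg₁, ← Category.assoc]
    congr 1
    ext <;> simp [hg₂]
  have hη' : IsRegularEpi (lift 0 (𝟙 X) ≫ c) := isRegularEpi_of_exists_lift hC _ fun P hP y => by
    obtain ⟨z, rfl⟩ := hP c hc y
    obtain ⟨g, hg₁, hg₂⟩ := exists_difunctional hP c (fst X X) z
      ((z ≫ fst X X) ≫ lift (𝟙 X) (𝟙 X)) 0 (by simp)
      (by simp only [Category.assoc, hΔ, comp_zero, zero_comp])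
    refine ⟨g ≫ snd X X, ?_⟩
    rw [← hg₁, ← Category.assoc]
    congr 1
    ext <;> simp [hg₂]
  refine ⟨Q, lift (𝟙 X) 0 ≫ c, exists_of_axes_of_isRegularEpi hC _ _ hη hη' c (𝟙 Q) (𝟙 Q)
    (by simp) (by simp), fun Y hY g => ?_⟩
  obtain ⟨d, hd₁, hd₂⟩ := exists_subtraction hY
  obtain ⟨t, ht⟩ := hdesc ((g ⊗ₘ g) ≫ d) (by
    have : lift (𝟙 X) (𝟙 X) ≫ (g ⊗ₘ g) = g ≫ lift (𝟙 Y) (𝟙 Y) := by ext <;> simp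
    rw [reassoc_of% this, hd₂, comp_zero])
  have htg : (lift (𝟙 X) 0 ≫ c) ≫ t = g := by
    have : lift (𝟙 X) 0 ≫ (g ⊗ₘ g) = g ≫ lift (𝟙 Y) 0 := by ext <;> simp
    rw [Category.assoc, ht, reassoc_of% this, hd₁, Category.comp_id]
  exact ⟨t, htg, fun t' ht' => by rw [← cancel_epi (lift (𝟙 X) 0 ≫ c), ht', htg]⟩

lemma isBirkhoff_unitalObjects (hC : EnoughRegularProjectives C) :
    IsBirkhoff (unitalObjects C) where
  reflective := exists_isReflection_unitalObjects hC
  of_mono X Y i hi := by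
    rintro ⟨m, h₁, h₂⟩
    have e₁ : lift (𝟙 X) 0 ≫ (i ⊗ₘ i) ≫ m = i := by
      have : lift (𝟙 X) 0 ≫ (i ⊗ₘ i) = i ≫ lift (𝟙 Y) 0 := by ext <;> simp
      rw [reassoc_of% this, h₁, Category.comp_id]
    have e₂ : lift 0 (𝟙 X) ≫ (i ⊗ₘ i) ≫ m = i := by
      have : lift 0 (𝟙 X) ≫ (i ⊗ₘ i) = i ≫ lift 0 (𝟙 Y) := by ext <;> simp
      rw [reassoc_of% this, h₂, Category.comp_id]
    -- The part of `X ⊗ X` that `m` sends into `X` contains both axes, so `m` restricts to `X`.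
    have := isIso_of_axes (pullback.snd i ((i ⊗ₘ i) ≫ m))
      ⟨pullback.lift (𝟙 X) (lift (𝟙 X) 0) (by rw [e₁, Category.id_comp]), pullback.lift_snd _ _ _⟩
      ⟨pullback.lift (𝟙 X) (lift 0 (𝟙 X)) (by rw [e₂, Category.id_comp]), pullback.lift_snd _ _ _⟩
    have h : (inv (pullback.snd i ((i ⊗ₘ i) ≫ m)) ≫ pullback.fst _ _) ≫ i = (i ⊗ₘ i) ≫ m := by
      rw [Category.assoc, pullback.condition, IsIso.inv_hom_id_assoc]
    refine ⟨inv (pullback.snd i ((i ⊗ₘ i) ≫ m)) ≫ pullback.fst _ _, ?_, ?_⟩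
    · rw [← cancel_mono i, Category.assoc, h, e₁, Category.id_comp]
    · rw [← cancel_mono i, Category.assoc, h, e₂, Category.id_comp]
  of_regularEpi X Y e he := by
    rintro ⟨m, h₁, h₂⟩
    exact exists_of_axes_of_isRegularEpi hC e e he he (m ≫ e) (𝟙 Y) (𝟙 Y)
      (by rw [reassoc_of% h₁, Category.comp_id]) (by rw [reassoc_of% h₂, Category.comp_id])

end Abelian

/-- The objects admitting an internal abelian group structure form a Birkhoff subcategory. -/
theorem isBirkhoff_abelianObjects {C : Type u} [Category.{v} C] [HasZeroMorphisms C]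
    [SemiAbelian C] (hC : EnoughRegularProjectives C) : IsBirkhoff (abelianObjects C) := by
  let : CartesianMonoidalCategory C := CartesianMonoidalCategory.ofHasFiniteProducts
  let : BraidedCategory C := BraidedCategory.ofCartesianMonoidalCategory
  have : abelianObjects C = unitalObjects C := by
    ext X
    exact exists_grpObj_isCommMonObj_iff
  rw [this]
  exact isBirkhoff_unitalObjects hC

end SemiAb

theorem mainTheorem5 {C : Type u} [Category.{v} C] [HasZeroMorphisms C] [SemiAb.SemiAbelian C]
    (hC : SemiAb.EnoughRegularProjectives C) :
    (∀ B : ObjectProperty C, SemiAb.IsBirkhoff B → SemiAb.abelianObjects C ≤ B →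
      SemiAb.UniversalityConditionsEquivalent B →
      ∀ ⦃Z Y X : C⦄ (f : Y ⟶ X) (g : Z ⟶ Y), SemiAb.IsPerfect B Y →
        SemiAb.IsCentralExtension B f → SemiAb.IsCentralExtension B g →
        SemiAb.IsCentralExtension B (g ≫ f)) ∧
    (SemiAb.UniversalityConditionsEquivalent (SemiAb.abelianObjects C) →
      SemiAb.ConditionUCE C) :=
  ⟨fun _ hB _ huniv _ _ _ _ _ hY hf hg => hf.comp hC hB huniv hY hg,
    fun huniv _ _ _ _ _ hY hf hg =>
      hf.comp hC (SemiAb.isBirkhoff_abelianObjects hC) huniv hY hg⟩
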